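/- Let $m,n\ge 1$ and consider the rectangular torus tiled by $2n$ horizontal rows of $m$ regular hexagons. A configuration $\sigma$ declares each hexagon filled or empty. A vertex $v$ of the tiling is in state $E,C,H,F$ in $\sigma$ (written $\sigma_v$) if $0,1,2,3$, respectively, of the three hexagons meeting at $v$ are filled (on very small tori, where a hexagon can meet $v$ in more than one corner, counted with multiplicity). A Hadwiger model is given by vertex energies $e_E=0$ and $e_C,e_H,e_F\in\mathbb R$; at temperature $T>0$ it is the probability distribution $\mathbb P_T$ on configurations with $\mathbb P_T(\sigma)\propto \exp\bigl(-\tfrac1T\sum_{v} e_{\sigma_v}\bigr)$, the sum being over all vertices of the torus. For two vertex states $A,B$, the model lies on the $A$–$B$ transition line if $e_A=e_B$ and this value is minimal among $e_E,e_C,e_H,e_F$. **Theorem.** (i) Suppose that the model lies on the $E$–$C$ transition line and $e_F\ge e_H$. Then for all $m,n\ge1$, all $T>0$ and every vertex $v$ of the torus, $$\mathbb P_T(\sigma_v\in\{H,F\})< e^{-2e_F/T}+3e^{-e_H/T}.$$ In particular, if $e_H>e_E=0$, this probability decays exponentially in the inverse temperature: there are constants $K,c>0$ depending only on the vertex energies,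 such that it is at most $Ke^{-c/T}$ for all $m,n\ge1$, all $T>0$ and every vertex $v$. (ii) Suppose that the model lies on the $H$–$F$ transition line and $e_E\ge e_C$. Then for all $m,n\ge1$, all $T>0$ and every vertex $v$ of the torus, $$\mathbb P_T(\sigma_v\in\{E,C\})< e^{-2(e_E-e_F)/T}+3e^{-(e_C-e_H)/T}.$$ In particular, if $e_C>e_H$, there are constants $K,c>0$ depending only on the vertex energies, such that this probability is at most $Ke^{-c/T}$ for all $m,n\ge1$, all $T>0$ and every vertex $v$. -/

import Mathlib

/-- The four states of a vertex of the hexagonal lattice: `E`, `C`, `H`, `F` mean that `0`, `1`, `2`,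
`3` of the three hexagons meeting at the vertex are filled. -/
inductive VertexState where
  | E | C | H | F

/-- A Hadwiger model, given by the energies of the non-empty vertex states (the empty state `E` has
energy `0`). -/
structure HadwigerModel where
  eC : ℝ
  eH : ℝ
  eF : ℝ

/-- The energy of a vertex state. -/
def HadwigerModel.energy (M : HadwigerModel) : VertexState → ℝ
  | .E => 0
  | .C => M.eC
  | .H => M.eH
  | .F => M.eF

/-- The model lies on the `A`-`B` transition line: `A` and `B` have equal energy, and this energy is
minimal among the four vertex states. -/
def HadwigerModel.OnTransitionLine (M : HadwigerModel) (A B : VertexState) : Prop :=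
  M.energy A = M.energy B ∧ ∀ X : VertexState, M.energy A ≤ M.energy X

/-- The hexagons of the rectangular torus made of `2 * n` horizontal rows of `m` hexagons each
(unit distance between the centers of adjacent hexagons; hexagons with two vertical sides).
The hexagon `(i, j, false)` lies in row `2 * j` and has center `(i, √3 * j)`;
the hexagon `(i, j, true)` lies in row `2 * j + 1` and has center `(i + 1 / 2, √3 * (j + 1 / 2))`. -/
abbrev TorusFace (m n : ℕ) : Type := ZMod m × ZMod n × Bool

namespace TorusFace

variable {m n : ℕ}

/-- The neighbor of a hexagon to the right: the center moves by `(1, 0)`. -/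
def right : TorusFace m n → TorusFace m n
  | (i, j, b) => (i + 1, j, b)

/-- The neighbor of a hexagon to the upper right: the center moves by `(1 / 2, √3 / 2)`. -/
def upRight : TorusFace m n → TorusFace m n
  | (i, j, false) => (i, j, true)
  | (i, j, true) => (i + 1, j + 1, false)

/-- The neighbor of a hexagon to the lower right: the center moves by `(1 / 2, -√3 / 2)`. -/
def downRight : TorusFace m n → TorusFace m n
  | (i, j, false) => (i, j - 1, true)
  | (i, j, true) => (i + 1, j, false)

end TorusFace

/-- The vertices of the torus: `(f, true)` is the common corner of `f` and its neighbors to the right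
and to the upper right, `(f, false)` is the common corner of `f` and its neighbors to the right and
to the lower right. Each vertex is listed exactly once in this way. -/
abbrev TorusVertex (m n : ℕ) : Type := TorusFace m n × Bool

/-- The three hexagons that meet at a vertex. -/
def TorusVertex.incidentFace {m n : ℕ} : TorusVertex m n → Fin 3 → TorusFace m n
  | (f, true) => ![f, f.right, f.upRight]
  | (f, false) => ![f, f.right, f.downRight]

/-- Configurations on the torus; `true` means filled. -/
abbrev TorusConfig (m n : ℕ) : Type := TorusFace m n → Bool

/-- The number of filled hexagons among the three corners meeting at a vertex. -/
def filledCount {m n : ℕ} (σ : TorusConfig m n) (v : TorusVertex m n) : ℕ :=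
  ∑ k : Fin 3, if σ (TorusVertex.incidentFace v k) = true then 1 else 0

/-- The state of a vertex in a configuration. -/
def vertexState {m n : ℕ} (σ : TorusConfig m n) (v : TorusVertex m n) : VertexState :=
  match filledCount σ v with
  | 0 => .E
  | 1 => .C
  | 2 => .H
  | _ => .F

namespace HadwigerModel

variable (M : HadwigerModel) {m n : ℕ} [NeZero m] [NeZero n]

/-- The Hamiltonian: the sum of the vertex energies. -/
noncomputable def hamiltonian (σ : TorusConfig m n) : ℝ :=
  ∑ v : TorusVertex m n, M.energy (vertexState σ v)

/-- The Boltzmann weight of a configuration at temperature `T`. -/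
noncomputable def weight (T : ℝ) (σ : TorusConfig m n) : ℝ :=
  Real.exp (-M.hamiltonian σ / T)

/-- The probability of an event under the Gibbs distribution of the model on the torus at
temperature `T`. -/
noncomputable def prob (T : ℝ) (A : Set (TorusConfig m n)) : ℝ :=
  (∑ σ : TorusConfig m n, A.indicator (M.weight T) σ) / ∑ σ : TorusConfig m n, M.weight T σ

end HadwigerModel

/-! This is a Peierls-type argument that needs only one local move. On the `E`–`C` line with `e_H ≤
e_F`, the vertex energy is nondecreasing in the number of filled corners, so emptying hexagons never
raises the energy anywhere. Around `v` there are as many patterns with at least two filled corners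
as with at most one, and `exists_thinning` matches them injectively by emptying hexagons only. This
gains at least `e_H - e_C` at `v`, so comparing weights gives a bound by the single term `exp (-(e_H
- e_C) / T)`, uniformly in the torus, which is stronger than the stated sum. The `H`–`F` line
follows by exchanging filled and empty. -/

/-- A Gibbs event is rare if it is mapped injectively into its complement by a map that lowers the
energy by a fixed amount. -/
theorem HadwigerModel.prob_lt_exp_of_injOn (M : HadwigerModel) {m n : ℕ} [NeZero m] [NeZero n]
    {T : ℝ} (hT : 0 < T) (A : Set (TorusConfig m n)) (φ : TorusConfig m n → TorusConfig m n) (d : ℝ)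
    (hφ : Set.InjOn φ A) (hmaps : ∀ σ ∈ A, φ σ ∉ A)
    (hd : ∀ σ ∈ A, M.hamiltonian (φ σ) + d ≤ M.hamiltonian σ) :
    M.prob T A < Real.exp (-d / T) := by
  classical
  have hpos (σ : TorusConfig m n) : 0 < M.weight T σ := Real.exp_pos _
  have hZ : 0 < ∑ σ : TorusConfig m n, M.weight T σ :=
    Finset.sum_pos (fun σ _ => hpos σ) Finset.univ_nonempty
  have hx : 0 < Real.exp (-d / T) := Real.exp_pos _
  have hA : ∑ σ : TorusConfig m n, A.indicator (M.weight T) σ =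
      ∑ σ ∈ Finset.univ.filter (· ∈ A), M.weight T σ := by
    simp [Finset.sum_filter, Set.indicator_apply]
  have hsplit := Finset.sum_filter_add_sum_filter_not Finset.univ (· ∈ A) (M.weight T)
  have hle : ∑ σ ∈ Finset.univ.filter (· ∈ A), M.weight T σ ≤
      Real.exp (-d / T) * ∑ σ ∈ Finset.univ.filter (· ∉ A), M.weight T σ := by
    calc ∑ σ ∈ Finset.univ.filter (· ∈ A), M.weight T σ
        ≤ ∑ σ ∈ Finset.univ.filter (· ∈ A), Real.exp (-d / T) * M.weight T (φ σ) := by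
          refine Finset.sum_le_sum fun σ hσ => ?_
          rw [HadwigerModel.weight, HadwigerModel.weight, ← Real.exp_add, ← add_div]
          refine Real.exp_le_exp.2 (div_le_div_of_nonneg_right ?_ hT.le)
          linarith [hd σ (by simpa using hσ)]
      _ = Real.exp (-d / T) *
            ∑ σ ∈ (Finset.univ.filter (· ∈ A)).image φ, M.weight T σ := by
          rw [Finset.sum_image (by simpa using hφ), Finset.mul_sum]
      _ ≤ _ := by
          refine mul_le_mul_of_nonneg_left
            (Finset.sum_le_sum_of_subset_of_nonneg ?_ fun σ _ _ => (hpos σ).le) hx.le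
          intro τ hτ
          obtain ⟨σ, hσ, rfl⟩ := Finset.mem_image.1 hτ
          simpa using hmaps σ (by simpa using hσ)
  rw [HadwigerModel.prob, hA, div_lt_iff₀ hZ, ← hsplit]
  -- Strictness: adding the weight of `A` to the right-hand side gains strictly if it is positive;
  -- otherwise the left-hand side vanishes.
  rcases (Finset.sum_nonneg fun σ _ => (hpos σ).le :
    0 ≤ ∑ σ ∈ Finset.univ.filter (· ∈ A), M.weight T σ).eq_or_lt with h0 | h0
  · rw [← h0, zero_add]
    rw [← h0, zero_add] at hsplit
    rw [hsplit]
    exact mul_pos hx hZ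
  · nlinarith [mul_pos hx h0]

theorem filledCount_eq {m n : ℕ} (σ : TorusConfig m n) (v : TorusVertex m n) :
    filledCount σ v = (σ (v.incidentFace 0)).toNat + (σ (v.incidentFace 1)).toNat +
      (σ (v.incidentFace 2)).toNat := by
  rw [filledCount, Fin.sum_univ_three]
  cases σ (v.incidentFace 0) <;> cases σ (v.incidentFace 1) <;> cases σ (v.incidentFace 2) <;> rfl

theorem filledCount_le_three {m n : ℕ} (σ : TorusConfig m n) (v : TorusVertex m n) :
    filledCount σ v ≤ 3 := by
  have h0 := Bool.toNat_le (σ (v.incidentFace 0))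
  have h1 := Bool.toNat_le (σ (v.incidentFace 1))
  have h2 := Bool.toNat_le (σ (v.incidentFace 2))
  rw [filledCount_eq]
  omega

theorem filledCount_mono {m n : ℕ} {σ τ : TorusConfig m n} (h : σ ≤ τ) (v : TorusVertex m n) :
    filledCount σ v ≤ filledCount τ v := by
  rw [filledCount_eq, filledCount_eq]
  gcongr <;> exact Bool.toNat_le_toNat (h _)

theorem filledCount_compl {m n : ℕ} (σ : TorusConfig m n) (v : TorusVertex m n) :
    filledCount σᶜ v = 3 - filledCount σ v := by
  rw [filledCount_eq, filledCount_eq]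
  simp only [Pi.compl_apply]
  cases σ (v.incidentFace 0) <;> cases σ (v.incidentFace 1) <;> cases σ (v.incidentFace 2) <;> rfl

/-- Corners `0` and `1` lie in one row and corner `2` in a row of the other parity. Only corners `0`
and `1` can coincide, namely when `m = 1`. -/
theorem TorusVertex.incidentFace_zero_ne_two {m n : ℕ} (v : TorusVertex m n) :
    v.incidentFace 0 ≠ v.incidentFace 2 := by
  obtain ⟨⟨i, j, b⟩, c⟩ := v
  cases b <;> cases c <;>
    simp [TorusVertex.incidentFace, TorusFace.upRight, TorusFace.downRight]

theorem TorusVertex.incidentFace_one_ne_two {m n : ℕ} (v : TorusVertex m n) :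
    v.incidentFace 1 ≠ v.incidentFace 2 := by
  obtain ⟨⟨i, j, b⟩, c⟩ := v
  cases b <;> cases c <;>
    simp [TorusVertex.incidentFace, TorusFace.right, TorusFace.upRight, TorusFace.downRight]

/-- Configurations with at least two filled corners at a vertex can be thinned injectively to
configurations with at most one filled corner there. -/
theorem exists_thinning {m n : ℕ} (v : TorusVertex m n) :
    ∃ φ : TorusConfig m n → TorusConfig m n, Set.InjOn φ {σ | 2 ≤ filledCount σ v} ∧
      (∀ σ, φ σ ≤ σ) ∧ ∀ σ, filledCount (φ σ) v ≤ 1 := by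
  classical
  have hac := v.incidentFace_zero_ne_two
  have hbc := v.incidentFace_one_ne_two
  simp only [filledCount_eq]
  generalize v.incidentFace 0 = a at *
  generalize v.incidentFace 1 = b at *
  generalize v.incidentFace 2 = c at *
  -- If `a = b`, a count of at least two forces the double corner to be filled; emptying it loses no
  -- information.
  by_cases hab : a = b
  · subst hab
    refine ⟨fun σ => Function.update σ a false, fun σ hσ τ hτ h => ?_, fun σ f => ?_, fun σ => ?_⟩
    · have full (ρ : TorusConfig m n)
          (hρ : 2 ≤ (ρ a).toNat + (ρ a).toNat + (ρ c).toNat) : ρ a = true := by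
        cases h1 : ρ a <;> cases h2 : ρ c <;> simp [h1, h2] at hρ ⊢
      funext f
      by_cases hf : f = a
      · rw [hf, full σ hσ, full τ hτ]
      · simpa [hf] using congrFun h f
    · by_cases hf : f = a <;> simp [hf]
    · simpa [hac.symm] using Bool.toNat_le (σ c)
  · have hba := Ne.symm hab
    have hca := hac.symm
    have hcb := hbc.symm
    -- A full triple is emptied. A filled pair keeps one hexagon, chosen cyclically: `ab ↦ a`, `bc ↦
    -- b`, `ca ↦ c`. The survivor thus identifies the pair.
    refine ⟨fun σ f => if f = a then σ a && σ b && !σ c else if f = b then σ b && σ c && !σ a else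
      if f = c then σ c && σ a && !σ b else σ f, fun σ hσ τ hτ h => ?_, fun σ f => ?_, fun σ => ?_⟩
    · have ha := congrFun h a
      have hb := congrFun h b
      have hc := congrFun h c
      simp only [Set.mem_ofPred_eq, if_true, if_neg hba, if_neg hca, if_neg hcb] at hσ hτ ha hb hc
      have key : σ a = τ a ∧ σ b = τ b ∧ σ c = τ c := by
        revert hσ hτ ha hb hc
        generalize σ a = x, σ b = y, σ c = z, τ a = x', τ b = y', τ c = z'
        revert x y z x' y' z'
        decide
      funext f
      by_cases hfa : f = a
      · rw [hfa, key.1]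
      by_cases hfb : f = b
      · rw [hfb, key.2.1]
      by_cases hfc : f = c
      · rw [hfc, key.2.2]
      simpa [hfa, hfb, hfc] using congrFun h f
    · have hand : ∀ x y z : Bool, (x && y && z) ≤ x := by decide
      dsimp only
      split_ifs with h1 h2 h3
      · rw [h1]
        exact hand _ _ _
      · rw [h2]
        exact hand _ _ _
      · rw [h3]
        exact hand _ _ _
      · exact le_rfl
    · simp only [if_true, if_neg hba, if_neg hca, if_neg hcb]
      cases σ a <;> cases σ b <;> cases σ c <;> decide

/-- Thinning at `v` lowers any energy that is a monotone function of the filled count. -/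
theorem sum_filledCount_add_le {m n : ℕ} [NeZero m] [NeZero n] (u : ℕ → ℝ)
    (hu : MonotoneOn u (Set.Iic 3)) {σ τ : TorusConfig m n} (hle : τ ≤ σ) (v : TorusVertex m n)
    (hτ : filledCount τ v ≤ 1) (hσ : 2 ≤ filledCount σ v) :
    ∑ w, u (filledCount τ w) + (u 2 - u 1) ≤ ∑ w, u (filledCount σ w) := by
  classical
  -- The gap `u 2 - u 1` comes from `v` alone; all other vertices only need monotonicity.
  rw [← Finset.add_sum_erase _ _ (Finset.mem_univ v),
    ← Finset.add_sum_erase Finset.univ (fun w => u (filledCount σ w)) (Finset.mem_univ v)]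
  have h1 : u (filledCount τ v) ≤ u 1 := hu (filledCount_le_three _ _) (by simp) hτ
  have h2 : u 2 ≤ u (filledCount σ v) := hu (by simp) (filledCount_le_three _ _) hσ
  have h3 : ∑ w ∈ Finset.univ.erase v, u (filledCount τ w) ≤
      ∑ w ∈ Finset.univ.erase v, u (filledCount σ w) :=
    Finset.sum_le_sum fun w _ =>
      hu (filledCount_le_three _ _) (filledCount_le_three _ _) (filledCount_mono hle w)
  linarith

/-- The energy of a vertex as a function of its filled count. -/
noncomputable def HadwigerModel.countEnergy (M : HadwigerModel) : ℕ → ℝ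
  | 0 => M.energy .E
  | 1 => M.energy .C
  | 2 => M.energy .H
  | _ => M.energy .F

theorem HadwigerModel.energy_vertexState (M : HadwigerModel) {m n : ℕ} (σ : TorusConfig m n)
    (v : TorusVertex m n) : M.energy (vertexState σ v) = M.countEnergy (filledCount σ v) := by
  unfold vertexState HadwigerModel.countEnergy
  split <;> simp_all

theorem vertexState_eq_F_or_H_iff {m n : ℕ} (σ : TorusConfig m n) (v : TorusVertex m n) :
    vertexState σ v = .F ∨ vertexState σ v = .H ↔ 2 ≤ filledCount σ v := by
  unfold vertexState
  split <;> simp_all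
  omega

theorem vertexState_eq_E_or_C_iff {m n : ℕ} (σ : TorusConfig m n) (v : TorusVertex m n) :
    vertexState σ v = .E ∨ vertexState σ v = .C ↔ filledCount σ v ≤ 1 := by
  unfold vertexState
  split <;> simp_all
  omega

theorem monotoneOn_Iic_three {u : ℕ → ℝ} (h01 : u 0 ≤ u 1) (h12 : u 1 ≤ u 2) (h23 : u 2 ≤ u 3) :
    MonotoneOn u (Set.Iic 3) := by
  intro i hi j hj hij
  rw [Set.mem_Iic] at hi hj
  interval_cases j <;> interval_cases i <;> linarith

theorem HadwigerModel.prob_F_or_H_lt (M : HadwigerModel) (hEC : M.energy .E ≤ M.energy .C)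
    (hCH : M.energy .C ≤ M.energy .H) (hHF : M.energy .H ≤ M.energy .F)
    {m n : ℕ} [NeZero m] [NeZero n] {T : ℝ} (hT : 0 < T) (v : TorusVertex m n) :
    M.prob T {σ : TorusConfig m n | vertexState σ v = .F ∨ vertexState σ v = .H} <
      Real.exp (-(M.energy .H - M.energy .C) / T) := by
  obtain ⟨φ, hinj, hle, hcount⟩ := exists_thinning v
  simp only [vertexState_eq_F_or_H_iff]
  refine M.prob_lt_exp_of_injOn hT _ φ _ hinj (fun σ _ => ?_) fun σ hσ => ?_
  · have := hcount σ
    simp only [Set.mem_ofPred_eq]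
    omega
  · simp only [HadwigerModel.hamiltonian, HadwigerModel.energy_vertexState]
    exact sum_filledCount_add_le M.countEnergy (monotoneOn_Iic_three hEC hCH hHF) (hle σ) v
      (hcount σ) hσ

/-- Complementation turns a count `k` into `3 - k`, so thinning the complement is a filling move,
and the energy is monotone in the number of empty corners. -/
theorem HadwigerModel.prob_E_or_C_lt (M : HadwigerModel) (hFH : M.energy .F ≤ M.energy .H)
    (hHC : M.energy .H ≤ M.energy .C) (hCE : M.energy .C ≤ M.energy .E)
    {m n : ℕ} [NeZero m] [NeZero n] {T : ℝ} (hT : 0 < T) (v : TorusVertex m n) :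
    M.prob T {σ : TorusConfig m n | vertexState σ v = .E ∨ vertexState σ v = .C} <
      Real.exp (-(M.energy .C - M.energy .H) / T) := by
  obtain ⟨φ, hinj, hle, hcount⟩ := exists_thinning v
  simp only [vertexState_eq_E_or_C_iff]
  have hc (σ : TorusConfig m n) (w : TorusVertex m n) := filledCount_compl σ w
  have hbd (σ : TorusConfig m n) (w : TorusVertex m n) := filledCount_le_three σ w
  have hflip (σ : TorusConfig m n) (hσ : filledCount σ v ≤ 1) : 2 ≤ filledCount σᶜ v := by
    rw [hc]
    omega
  refine M.prob_lt_exp_of_injOn hT _ (fun σ => (φ σᶜ)ᶜ) _ (fun σ hσ τ hτ h => ?_)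
    (fun σ _ => ?_) fun σ hσ => ?_
  · exact compl_injective (hinj (hflip σ hσ) (hflip τ hτ) (compl_injective h))
  · have h1 := hcount σᶜ
    simp only [Set.mem_ofPred_eq, hc]
    omega
  · have h := sum_filledCount_add_le (fun k => M.countEnergy (3 - k))
      (monotoneOn_Iic_three hFH hHC hCE) (hle σᶜ) v (hcount σᶜ) (hflip σ hσ)
    simp only [← filledCount_compl, compl_compl] at h
    simp only [HadwigerModel.hamiltonian, HadwigerModel.energy_vertexState]
    exact h

theorem mainTheorem5 (M : HadwigerModel) :
    (M.OnTransitionLine .E .C → M.energy .H ≤ M.energy .F →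
      (∀ (m n : ℕ) [NeZero m] [NeZero n] (T : ℝ), 0 < T → ∀ v : TorusVertex m n,
        M.prob T {σ : TorusConfig m n | vertexState σ v = .F ∨ vertexState σ v = .H} <
          Real.exp (-(2 * M.energy .F) / T) + 3 * Real.exp (-M.energy .H / T)) ∧
      (M.energy .E < M.energy .H → ∃ K c : ℝ, 0 < K ∧ 0 < c ∧
        ∀ (m n : ℕ) [NeZero m] [NeZero n] (T : ℝ), 0 < T → ∀ v : TorusVertex m n,
          M.prob T {σ : TorusConfig m n | vertexState σ v = .F ∨ vertexState σ v = .H} ≤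
            K * Real.exp (-c / T))) ∧
    (M.OnTransitionLine .H .F → M.energy .C ≤ M.energy .E →
      (∀ (m n : ℕ) [NeZero m] [NeZero n] (T : ℝ), 0 < T → ∀ v : TorusVertex m n,
        M.prob T {σ : TorusConfig m n | vertexState σ v = .E ∨ vertexState σ v = .C} <
          Real.exp (-(2 * (M.energy .E - M.energy .F)) / T) +
            3 * Real.exp (-(M.energy .C - M.energy .H) / T)) ∧
      (M.energy .H < M.energy .C → ∃ K c : ℝ, 0 < K ∧ 0 < c ∧
        ∀ (m n : ℕ) [NeZero m] [NeZero n] (T : ℝ), 0 < T → ∀ v : TorusVertex m n,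
          M.prob T {σ : TorusConfig m n | vertexState σ v = .E ∨ vertexState σ v = .C} ≤
            K * Real.exp (-c / T))) := by
  constructor
  · rintro ⟨hEC, hmin⟩ hHF
    have hlt (m n : ℕ) [NeZero m] [NeZero n] (T : ℝ) (hT : 0 < T) (v : TorusVertex m n) :
        M.prob T {σ : TorusConfig m n | vertexState σ v = .F ∨ vertexState σ v = .H} <
          Real.exp (-M.energy .H / T) := by
      -- On this line `e_C = e_E = 0`, so the gap `e_H - e_C` is `e_H` itself.
      have h := M.prob_F_or_H_lt hEC.le (hEC ▸ hmin .H) hHF hT v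
      rwa [← hEC, HadwigerModel.energy.eq_1, sub_zero] at h
    refine ⟨fun m n _ _ T hT v => ?_, fun h => ⟨1, M.energy .H, one_pos, h, fun m n _ _ T hT v => ?_⟩⟩
    · linarith [hlt m n T hT v, Real.exp_pos (-(2 * M.energy .F) / T),
        Real.exp_pos (-M.energy .H / T)]
    · linarith [hlt m n T hT v]
  · rintro ⟨hHF, hmin⟩ hCE
    have hlt (m n : ℕ) [NeZero m] [NeZero n] (T : ℝ) (hT : 0 < T) (v : TorusVertex m n) :=
      M.prob_E_or_C_lt hHF.ge (hmin .C) hCE hT v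
    refine ⟨fun m n _ _ T hT v => ?_, fun h => ⟨1, M.energy .C - M.energy .H, one_pos, sub_pos.2 h,
      fun m n _ _ T hT v => ?_⟩⟩
    · linarith [hlt m n T hT v, Real.exp_pos (-(2 * (M.energy .E - M.energy .F)) / T),
        Real.exp_pos (-(M.energy .C - M.energy .H) / T)]
    · linarith [hlt m n T hT v]
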